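/- Let $p$ be a prime number. For a finite $p$-group $G$, let $\Phi(G)$ be its Frattini subgroup, $Z(\Phi(G))$ the center of $\Phi(G)$, and let $G/\Phi(G)$ act on $Z(\Phi(G))$ by conjugation. A finite nonabelian $p$-group $G$ is called an NS-group if $$\hat H^0\bigl(G/\Phi(G);\,Z(\Phi(G))\bigr)=0,$$ where $\hat H^0$ denotes Tate cohomology in degree $0$. Proposition. Let $G$ be an NS-group of order $p^{p+6}$. Then: (a) $d(G)=2$, where $d(G)$ is the minimal number of generators of $G$; (b) $|Z(\Phi(G))|=p^{p+2}$; (c) $Z(G)$ is cyclic of order $p$. -/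

import Mathlib

universe u

noncomputable section

variable (G : Type u) [Group G]

/-- The conjugation action of `G` on `Z(Φ(G))`, as a homomorphism to the automorphism group. -/
def conjCenterFrattini : G →* MulAut (Subgroup.center (frattini G)) where
  toFun g := Subgroup.centerCongr (MulAut.conjNormal g : MulAut (frattini G))
  map_one' := by
    ext z
    exact congrArg Subtype.val (DFunLike.congr_fun (map_one MulAut.conjNormal) (z : frattini G))
  map_mul' g h := by
    ext z
    exact congrArg Subtype.val (DFunLike.congr_fun (map_mul MulAut.conjNormal g h) (z : frattini G))

theorem conjCenterFrattini_apply (g : G) (z : Subgroup.center (frattini G)) :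
    ((conjCenterFrattini G g z : frattini G) : G) = g * ((z : frattini G) : G) * g⁻¹ :=
  rfl

theorem frattini_le_ker_conjCenterFrattini :
    frattini G ≤ (conjCenterFrattini G).ker := by
  intro g hg
  rw [MonoidHom.mem_ker]
  ext z
  rw [conjCenterFrattini_apply]
  have h := congrArg (Subtype.val) ((Subgroup.mem_center_iff.mp z.2) ⟨g, hg⟩)
  simp only [Subgroup.coe_mul] at h
  rw [h]
  simp

/-- The conjugation action of the Frattini quotient `G/Φ(G)` on `Z(Φ(G))`:
`gΦ(G)` acts by `z ↦ g z g⁻¹`. -/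
def frattiniQuotientAction : G ⧸ frattini G →* MulAut (Subgroup.center (frattini G)) :=
  QuotientGroup.lift (frattini G) (conjCenterFrattini G) (frattini_le_ker_conjCenterFrattini G)

theorem frattiniQuotientAction_mk_apply (g : G) (z : Subgroup.center (frattini G)) :
    ((frattiniQuotientAction G (QuotientGroup.mk g) z : frattini G) : G)
      = g * ((z : frattini G) : G) * g⁻¹ :=
  rfl

open scoped IsMulCommutative in
/-- `Z(Φ(G))`, written additively, as a `ℤ[G/Φ(G)]`-module through the conjugation action.
The coefficient ring is a copy of `ℤ` in the universe of `G`, because Tate cohomology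
asks that the ring and the group live in the same universe. -/
def centerFrattiniRepresentation :
    Representation (ULift.{u} ℤ) (G ⧸ frattini G) (Additive (Subgroup.center (frattini G))) where
  toFun q :=
    { toFun := fun a => Additive.ofMul (frattiniQuotientAction G q a.toMul)
      map_add' := fun a b => map_mul (frattiniQuotientAction G q) a.toMul b.toMul
      map_smul' := fun n a => map_zpow (frattiniQuotientAction G q) a.toMul n.down }
  map_one' := by
    ext a
    simp
  map_mul' q r := by
    ext a
    simp only [map_mul]
    rfl

open scoped IsMulCommutative in
theorem centerFrattiniRepresentation_mk_apply (g : G) (z : Subgroup.center (frattini G)) :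
    centerFrattiniRepresentation G (QuotientGroup.mk g) (Additive.ofMul z) =
      Additive.ofMul (conjCenterFrattini G g z) :=
  rfl

open scoped IsMulCommutative in
/-- `Ĥ⁰(G/Φ(G); Z(Φ(G)))`. -/
def tateZeroCenterFrattini [Finite G] : ModuleCat.{u} (ULift.{u} ℤ) :=
  letI : Fintype (G ⧸ frattini G) := Fintype.ofFinite _
  tateCohomology (Rep.of (centerFrattiniRepresentation G)) 0

/-- `G` is an NS-group for the prime `p`: a finite nonabelian `p`-group such that
`Ĥ⁰(G/Φ(G); Z(Φ(G))) = 0`. -/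
structure IsNSGroup (p : ℕ) (G : Type u) [Group G] [Finite G] : Prop where
  isPGroup : IsPGroup p G
  nonabelian : ∃ a b : G, a * b ≠ b * a
  tate_zero : Subsingleton (tateZeroCenterFrattini G)

end

/-!
Write `Φ` for the Frattini subgroup of `G`, `A = Z(Φ)` additively and `Q = G/Φ`, an elementary
abelian group of rank `d`. Vanishing of `Ĥ⁰(Q; A)` means that every element of `F = A ^ Q` is a
norm `N_Q a`. This is used only through factorizations `N_Q = S N_K N_g N_h` of the norm along
independent elements of `Q`, and through the fact that `F = pF` is impossible for `F ≠ 0`.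

* If `g ∉ K` acted trivially on `A ^ K`, then `N_g` would be multiplication by `p` there and
  `F = pF` (`exists_mem_fixedBy_smul_ne`). For `K = 1` this says that `Q` acts faithfully, so
  `Z(G) ≤ Φ` and `Z(G)` is `F`. In general it gives `|A ^ K| ≥ p |F|`.
* If moreover `h ∉ K ⊔ ⟨g⟩`, the same argument shows that `N_h` does not vanish on
  `B = (g - 1) A ^ K`. Since `N_g` kills `B`, the element `p` acts on `B` as `(g - 1) ^ (p - 1)`
  up to sign and a unipotent factor, so `N_h ∈ (h - 1) ^ (p - 1) + (p)` maps `B` into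
  `I ^ (p - 1) B` for `I = (g - 1, h - 1)`, and `I ^ (p - 1) B ≠ 0`. As `I` acts nilpotently, the
  filtration of `B` by powers of `I` is strict, whence `|B| ≥ p ^ p` and
  `|A ^ K| ≥ p ^ p |A ^ (K ⊔ ⟨g⟩)|` (`prime_pow_mul_card_fixedBy_sup_le`).

Thus `|A| ≥ p ^ (2p + 2)` if `d ≥ 3`, which is too large for `|G| = p ^ (p + 6)`; as `G` is not
cyclic, `d = 2`, and `|A| ≥ p ^ (p + 1) |F|`.

Next, `Φ` is not abelian. Suppose it is, with `G` generated by `x` and `y`. Triviality of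
`Ĥ⁰(Q; A)` passes to `⟨x⟩` in degrees `0` and `-1` (`ker_sub_one_eq_range_geom_sum`,
`ker_geom_sum_eq_range_sub_one`). Degree `0` permits a change of `x` within its coset of `Φ` to
achieve `x ^ p = 1`; the commutator of `x` and `y` then has trivial norm, and degree `-1` permits
a change of `y` to make the two commute (`exists_commuting_lifts`), so `G` would be abelian. Hence
`Z(Φ)` has index at least `p ^ 2` in `Φ`, which has order `p ^ (p + 4)`. So `|A| = p ^ (p + 2)`,
and the bound `|A| ≥ p ^ (p + 1) |F|` leaves `|Z(G)| = |F| = p`.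
-/

section

open Finset

/-! ### Operators of order `p` on finite modules of `p`-power order -/

/-- For `p` prime, the norm `1 + g + ⋯ + g ^ (p - 1)` of `g = 1 + y` is `y ^ (p - 1)` plus `p` times
an element that is unipotent when `y` is nilpotent. -/
theorem geom_sum_one_add_eq {R : Type*} [CommRing R] {p : ℕ} (hp : p.Prime) (y : R) :
    ∃ r : R, ∑ i ∈ range p, (1 + y) ^ i = y ^ (p - 1) + p * (1 + y * r) := by
  obtain ⟨k, rfl⟩ : ∃ k, p = k + 2 := ⟨p - 2, by have := hp.two_le; omega⟩
  have h := congrArg (Polynomial.aeval y)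
    (Polynomial.geom_sum_X_comp_X_add_one_eq_sum (R := ℤ) (k + 2))
  simp only [Polynomial.aeval_comp, map_sum, map_pow, map_add, map_one, Polynomial.aeval_X,
    map_mul, map_natCast] at h
  have hd : ∀ i ∈ range k, ((k + 2).choose (i + 1 + 1) : R) * y ^ (i + 1)
      = ((k + 2 : ℕ) : R) * (y * (((k + 2).choose (i + 2) / (k + 2) : ℕ) * y ^ i)) := by
    intro i hi
    have hi' := mem_range.1 hi
    have hdvd : k + 2 ∣ (k + 2).choose (i + 2) :=
      hp.dvd_choose_self (by omega) (by omega)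
    nth_rewrite 1 [show (k + 2).choose (i + 1 + 1) =
      (k + 2) * ((k + 2).choose (i + 2) / (k + 2)) from (Nat.mul_div_cancel' hdvd).symm]
    push_cast
    ring
  refine ⟨∑ i ∈ range k, (((k + 2).choose (i + 2) / (k + 2) : ℕ) : R) * y ^ i, ?_⟩
  rw [add_comm 1 y, h, sum_range_succ, sum_range_succ', sum_congr rfl hd, ← mul_sum, ← mul_sum]
  simp
  ring

theorem exists_sub_one_pow_eq_prime_mul {R : Type*} [CommRing R] {p : ℕ} (hp : p.Prime) {g : R}
    (hg : g ^ p = 1) : ∃ t : R, (g - 1) ^ p = p * t := by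
  obtain ⟨r, hr⟩ := exists_add_pow_prime_eq hp (g - 1) 1
  refine ⟨-((g - 1) * 1 * r), ?_⟩
  rw [sub_add_cancel, hg, one_pow] at hr
  linear_combination -hr

variable {R M : Type*} [CommRing R] [AddCommGroup M] [Module R M]

theorem sub_one_mem_radical_annihilator {p k : ℕ} (hp : p.Prime) (hM : Nat.card M = p ^ k) {g : R}
    (hg : g ^ p = 1) : g - 1 ∈ (Module.annihilator R M).radical := by
  obtain ⟨t, ht⟩ := exists_sub_one_pow_eq_prime_mul hp hg
  refine ⟨p * k, Module.mem_annihilator.2 fun m => ?_⟩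
  rw [pow_mul, ht, mul_pow, mul_comm, mul_smul, ← Nat.cast_pow, Nat.cast_smul_eq_nsmul, ← hM,
    card_nsmul_eq_zero', smul_zero]

namespace Submodule

theorem exists_card_eq_prime_pow {p k : ℕ} (hp : p.Prime) (hM : Nat.card M = p ^ k)
    (N : Submodule R M) : ∃ j, Nat.card N = p ^ j := by
  obtain ⟨j, -, hj⟩ := (Nat.dvd_prime_pow hp).1 (hM ▸ N.toAddSubgroup.card_addSubgroup_dvd_card)
  exact ⟨j, hj⟩

theorem prime_mul_card_le_of_lt [Finite M] {p k : ℕ} (hp : p.Prime) (hM : Nat.card M = p ^ k)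
    {N N' : Submodule R M} (h : N < N') : p * Nat.card N ≤ Nat.card N' := by
  obtain ⟨i, hi⟩ := N.exists_card_eq_prime_pow hp hM
  obtain ⟨j, hj⟩ := N'.exists_card_eq_prime_pow hp hM
  have hlt : Nat.card N < Nat.card N' :=
    Set.ncard_lt_ncard (s := (N : Set M)) (t := (N' : Set M)) h
  rw [hi, hj] at *
  rw [← pow_succ']
  exact Nat.pow_le_pow_right hp.pos ((Nat.pow_lt_pow_iff_right hp.one_lt).1 hlt)

theorem smul_lt_of_le_radical_annihilator {I : Ideal R} (hI : I.FG)
    (hrad : I ≤ (Module.annihilator R M).radical) {N : Submodule R M} (hN : N ≠ ⊥) :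
    I • N < N := by
  refine lt_of_le_of_ne Submodule.smul_le_right fun h => hN ?_
  obtain ⟨n, hn⟩ := Ideal.exists_pow_le_of_le_radical_of_fg hrad hI
  have hpow : ∀ i : ℕ, I ^ i • N = N := by
    intro i
    induction i with
    | zero => simp
    | succ i ih => rw [pow_succ, mul_smul, h, ih]
  rw [eq_bot_iff, ← hpow n, Submodule.smul_le]
  intro r hr m _
  rw [Module.mem_annihilator.1 (hn hr) m]
  exact zero_mem _

/-- The filtration of `N` by the powers of an ideal acting nilpotently descends strictly until it
reaches zero. -/
theorem prime_pow_le_card_of_pow_smul_ne_bot [Finite M] {p k : ℕ} (hp : p.Prime)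
    (hM : Nat.card M = p ^ k) {I : Ideal R} (hI : I.FG)
    (hrad : I ≤ (Module.annihilator R M).radical) (n : ℕ) {N : Submodule R M}
    (h : I ^ n • N ≠ ⊥) : p ^ (n + 1) ≤ Nat.card N := by
  induction n generalizing N with
  | zero =>
    have hN : ⊥ < N := bot_lt_iff_ne_bot.2 (by simpa using h)
    simpa using prime_mul_card_le_of_lt hp hM hN
  | succ n ih =>
    rw [pow_succ, mul_smul] at h
    have hN : N ≠ ⊥ := by
      rintro rfl
      simp at h
    calc p ^ (n + 1 + 1) = p * p ^ (n + 1) := pow_succ' _ _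
      _ ≤ p * Nat.card ↥(I • N) := Nat.mul_le_mul_left _ (ih h)
      _ ≤ Nat.card N :=
        prime_mul_card_le_of_lt hp hM (smul_lt_of_le_radical_annihilator hI hrad hN)

end Submodule

theorem LinearMap.card_ker_mul_card_range [Finite M] (φ : M →ₗ[R] M) :
    Nat.card (LinearMap.ker φ) * Nat.card (LinearMap.range φ) = Nat.card M := by
  have h := Submodule.card_eq_card_quotient_mul_card (LinearMap.ker φ)
  rw [h, Nat.card_congr φ.quotKerEquivRange.toEquiv, mul_comm]

/-- A Herbrand quotient argument: for two endomorphisms of a finite module with `φ ∘ ψ = 0` and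
`ψ ∘ φ = 0`, exactness on one side gives exactness on the other, by counting. -/
theorem LinearMap.ker_eq_range_of_ker_eq_range [Finite M] {φ ψ : M →ₗ[R] M}
    (h : LinearMap.range φ ≤ LinearMap.ker ψ) (hex : LinearMap.ker φ = LinearMap.range ψ) :
    LinearMap.ker ψ = LinearMap.range φ := by
  have h1 := LinearMap.card_ker_mul_card_range φ
  have h2 := LinearMap.card_ker_mul_card_range ψ
  have hpos : 0 < Nat.card (LinearMap.range ψ) := Nat.card_pos
  rw [hex, ← h2, mul_comm] at h1
  have hcard := Nat.eq_of_mul_eq_mul_right hpos h1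
  refine (SetLike.coe_injective (Set.eq_of_subset_of_ncard_le h ?_)).symm
  exact hcard.ge

/-- If the norm of `h` does not vanish on `(g - 1)M`, then neither does the `(p - 1)`-st power of
the ideal `(g - 1, h - 1)`, whence `(g - 1)M` has at least `p ^ p` elements. -/
theorem prime_pow_le_card_range_sub_one [Finite M] {p k : ℕ} (hp : p.Prime)
    (hM : Nat.card M = p ^ k) {g h : R} (hg : g ^ p = 1) (hh : h ^ p = 1)
    (hne : ∃ m : M, (∑ i ∈ range p, h ^ i) • (g - 1) • m ≠ 0) :
    p ^ p ≤ Nat.card (LinearMap.range (LinearMap.lsmul R M (g - 1))) := by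
  set N := LinearMap.range (LinearMap.lsmul R M (g - 1))
  obtain ⟨m, hm⟩ := hne
  have hgrad := sub_one_mem_radical_annihilator (M := M) hp hM hg
  have hhrad := sub_one_mem_radical_annihilator (M := M) hp hM hh
  have key : Ideal.span {g - 1, h - 1} ^ (p - 1) • N ≠ ⊥ := by
    intro hbot
    set b := (g - 1) • m
    have hb : b ∈ N := ⟨m, rfl⟩
    have hzero : ∀ x ∈ Ideal.span {g - 1, h - 1}, x ^ (p - 1) • b = 0 := fun x hx => by
      have := Submodule.smul_mem_smul (Ideal.pow_mem_pow hx (p - 1)) hb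
      rwa [hbot, Submodule.mem_bot] at this
    have hx := hzero (g - 1) (Ideal.subset_span (by simp))
    have hy := hzero (h - 1) (Ideal.subset_span (by simp))
    obtain ⟨r, hr⟩ := geom_sum_one_add_eq hp (g - 1)
    obtain ⟨s, hs⟩ := geom_sum_one_add_eq hp (h - 1)
    rw [add_sub_cancel] at hr hs
    have hNg : (∑ i ∈ range p, g ^ i) • b = 0 := by
      rw [smul_smul, geom_sum_mul, hg, sub_self, zero_smul]
    -- on `b` the norm of `g` is `p` times a unipotent element, so `p` kills `b`
    have hpb : (p : R) • b = 0 := by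
      have h1 : (p : R) • b = (-((g - 1) * r)) • (p : R) • b := by
        have h0 : ((g - 1) ^ (p - 1) + p * (1 + (g - 1) * r)) • b = 0 := hr ▸ hNg
        rw [add_smul, hx, zero_add] at h0
        rw [← sub_eq_zero, ← h0, smul_smul _ _ b, ← sub_smul]
        congr 1
        ring
      have h2 : ∀ n : ℕ, (p : R) • b = (-((g - 1) * r)) ^ n • (p : R) • b := by
        intro n
        induction n with
        | zero => simp
        | succ n ih => rw [pow_succ, mul_smul, ← h1, ← ih]
      obtain ⟨n, hn⟩ := hgrad
      have h3 : (-((g - 1) * r)) ^ n ∈ Module.annihilator R M := by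
        rw [show (-((g - 1) * r)) ^ n = (-r) ^ n * (g - 1) ^ n by rw [← mul_pow]; ring]
        exact Ideal.mul_mem_left _ _ hn
      rw [h2 n, Module.mem_annihilator.1 h3]
    apply hm
    rw [hs, add_smul, hy, mul_comm, mul_smul, hpb, smul_zero, zero_add]
  have := Submodule.prime_pow_le_card_of_pow_smul_ne_bot hp hM
    (Submodule.fg_span (Set.toFinite _)) (Ideal.span_le.2 ?_) (p - 1) key
  · rwa [Nat.sub_add_cancel hp.pos] at this
  · rintro x (rfl | rfl)
    exacts [hgrad, hhrad]

/-- If `F = pF` in a finite `p`-group then `F = 0`. -/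
theorem Submodule.eq_bot_of_forall_exists_prime_smul {p k : ℕ} (hM : Nat.card M = p ^ k)
    {F : Submodule R M} (h : ∀ m ∈ F, ∃ n ∈ F, (p : R) • n = m) : F = ⊥ := by
  have hpow : ∀ i : ℕ, ∀ m ∈ F, ∃ n ∈ F, (p : R) ^ i • n = m := by
    intro i
    induction i with
    | zero => exact fun m hm => ⟨m, hm, by simp⟩
    | succ i ih =>
      intro m hm
      obtain ⟨n, hn, rfl⟩ := ih m hm
      obtain ⟨n', hn', rfl⟩ := h n hn
      exact ⟨n', hn', by rw [pow_succ, mul_smul]⟩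
  rw [eq_bot_iff]
  intro m hm
  obtain ⟨n, -, rfl⟩ := hpow k m hm
  rw [Submodule.mem_bot, ← Nat.cast_pow, Nat.cast_smul_eq_nsmul, ← hM, card_nsmul_eq_zero']

theorem geom_sum_smul_of_smul_eq_self {g : R} {m : M} (h : g • m = m) (n : ℕ) :
    (∑ i ∈ range n, g ^ i) • m = (n : R) • m := by
  have hi : ∀ i : ℕ, g ^ i • m = m := by
    intro i
    induction i with
    | zero => simp
    | succ i ih => rw [pow_succ, mul_smul, h, ih]
  simp [Finset.sum_smul, hi, Nat.cast_smul_eq_nsmul]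

theorem smul_geom_sum_smul {p : ℕ} {g : R} (hg : g ^ p = 1) (m : M) :
    g • (∑ i ∈ range p, g ^ i) • m = (∑ i ∈ range p, g ^ i) • m := by
  rw [← sub_eq_zero, smul_smul, ← sub_smul]
  have := mul_geom_sum g p
  rw [hg, sub_self] at this
  rw [show g * ∑ i ∈ range p, g ^ i - ∑ i ∈ range p, g ^ i =
    (g - 1) * ∑ i ∈ range p, g ^ i by ring, this, zero_smul]

/-- Suppose that every element of `F` is of the form `S N_g N_h n`, where `S` maps elements fixed by
`g` and `h` into `F`. If `N_h` vanished on `(g - 1)M`, every `N_h n` would be fixed by `g`, so that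
`N_g` would multiply it by `p` and `F = pF`. Hence `(g - 1)M` is large. -/
theorem prime_pow_mul_card_ker_le [Finite M] {p k : ℕ} (hp : p.Prime)
    (hM : Nat.card M = p ^ k) {g h S : R} (hg : g ^ p = 1) (hh : h ^ p = 1) {F : Submodule R M}
    (hF : F ≠ ⊥)
    (hnorm : ∀ m ∈ F, ∃ n : M,
      S • (∑ i ∈ range p, g ^ i) • (∑ i ∈ range p, h ^ i) • n = m)
    (hS : ∀ m : M, g • m = m → h • m = m → S • m ∈ F) :
    p ^ p * Nat.card (LinearMap.ker (LinearMap.lsmul R M (g - 1))) ≤ Nat.card M := by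
  rw [← LinearMap.card_ker_mul_card_range (LinearMap.lsmul R M (g - 1)), mul_comm]
  refine Nat.mul_le_mul_left _ (prime_pow_le_card_range_sub_one hp hM hg hh ?_)
  by_contra! hzero
  refine hF (Submodule.eq_bot_of_forall_exists_prime_smul hM fun m hm => ?_)
  obtain ⟨n, rfl⟩ := hnorm m hm
  have hgn : g • (∑ i ∈ range p, h ^ i) • n = (∑ i ∈ range p, h ^ i) • n := by
    have := hzero n
    rw [smul_comm, sub_smul, one_smul, sub_eq_zero] at this
    exact this
  refine ⟨_, hS _ hgn (smul_geom_sum_smul hh n), ?_⟩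
  rw [geom_sum_smul_of_smul_eq_self hgn, smul_comm]

/-- If `g` acted trivially, its norm would be multiplication by `p`, giving `F = pF`. -/
theorem exists_smul_ne_of_norm {p k : ℕ} (hM : Nat.card M = p ^ k) {g S : R}
    {F : Submodule R M} (hF : F ≠ ⊥)
    (hnorm : ∀ m ∈ F, ∃ n : M, S • (∑ i ∈ range p, g ^ i) • n = m)
    (hS : ∀ m : M, g • m = m → S • m ∈ F) : ∃ m : M, g • m ≠ m := by
  by_contra! htriv
  refine hF (Submodule.eq_bot_of_forall_exists_prime_smul hM fun m hm => ?_)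
  obtain ⟨n, rfl⟩ := hnorm m hm
  refine ⟨_, hS n (htriv n), ?_⟩
  rw [geom_sum_smul_of_smul_eq_self (htriv n), smul_comm]

/-- Let `g` and `h` be commuting operators of order dividing `p`. If every element fixed by both is
of the form `N_g N_h n`, then `g` alone has trivial Tate cohomology in degree `0`. -/
theorem ker_sub_one_eq_range_geom_sum [Finite M] {p k : ℕ} (hp : p.Prime)
    (hM : Nat.card M = p ^ k) {g h : R} (hg : g ^ p = 1) (hh : h ^ p = 1)
    (hnorm : ∀ m : M, g • m = m → h • m = m →
      ∃ n : M, (∑ i ∈ range p, g ^ i) • (∑ i ∈ range p, h ^ i) • n = m) :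
    LinearMap.ker (LinearMap.lsmul R M (g - 1)) =
      LinearMap.range (LinearMap.lsmul R M (∑ i ∈ range p, g ^ i)) := by
  have mem_ker : ∀ (a : R) (m : M), (a - 1) • m = 0 ↔ a • m = m := fun a m => by
    rw [sub_smul, one_smul, sub_eq_zero]
  set N := LinearMap.range (LinearMap.lsmul R M (∑ i ∈ range p, g ^ i))
  have hfix : ∀ n ∈ N, g • n = n := by
    rintro _ ⟨n, rfl⟩
    exact smul_geom_sum_smul hg n
  -- degree `0`, hence also degree `-1`, vanishes for `h` acting on the norms `N` of `g`
  have hNh : LinearMap.ker (LinearMap.lsmul R N (∑ i ∈ range p, h ^ i)) =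
      LinearMap.range (LinearMap.lsmul R N (h - 1)) := by
    refine LinearMap.ker_eq_range_of_ker_eq_range ?_ (le_antisymm ?_ ?_)
    · rintro _ ⟨n, rfl⟩
      rw [LinearMap.mem_ker, LinearMap.lsmul_apply, LinearMap.lsmul_apply, smul_smul,
        geom_sum_mul, hh, sub_self, zero_smul]
    · intro m hm
      rw [LinearMap.mem_ker, LinearMap.lsmul_apply] at hm
      have hm' : h • (m : M) = m := (mem_ker h _).1 (congrArg Subtype.val hm)
      obtain ⟨n, hn⟩ := hnorm m (hfix m m.2) hm'
      refine ⟨⟨(∑ i ∈ range p, g ^ i) • n, n, rfl⟩, Subtype.ext ?_⟩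
      rw [← hn, smul_comm]
      rfl
    · rintro _ ⟨n, rfl⟩
      rw [LinearMap.mem_ker, LinearMap.lsmul_apply, LinearMap.lsmul_apply, sub_smul, one_smul,
        smul_geom_sum_smul hh, sub_self]
  have step : ∀ t : M, g • t = t → (h - 1) • t ∈ N → t ∈ N := by
    intro t ht htN
    have h1 : (⟨(h - 1) • t, htN⟩ : N) ∈
        LinearMap.ker (LinearMap.lsmul R N (∑ i ∈ range p, h ^ i)) := by
      rw [LinearMap.mem_ker, LinearMap.lsmul_apply]
      refine Subtype.ext ?_
      change (∑ i ∈ range p, h ^ i) • (h - 1) • t = 0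
      rw [smul_smul, geom_sum_mul, hh, sub_self, zero_smul]
    rw [hNh] at h1
    obtain ⟨n, hn⟩ := h1
    have hn' : (h - 1) • (n : M) = (h - 1) • t := congrArg Subtype.val hn
    have hsub : t - n ∈ N := by
      obtain ⟨w, hw⟩ := hnorm (t - n) (by rw [smul_sub, ht, hfix n n.2])
        ((mem_ker h _).1 (by rw [smul_sub, hn', sub_self]))
      exact hw ▸ ⟨_, rfl⟩
    simpa using N.add_mem hsub n.2
  refine le_antisymm (fun c hc => ?_) fun n hn => (mem_ker g n).2 (hfix n hn)
  have hc' : g • c = c := (mem_ker g c).1 hc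
  -- `h - 1` is injective on `ker (g - 1) / N` by `step`, but also nilpotent
  obtain ⟨n, hn⟩ := sub_one_mem_radical_annihilator (M := M) hp hM hh
  have down : ∀ j : ℕ, (h - 1) ^ j • c ∈ N → c ∈ N := by
    intro j
    induction j with
    | zero => simp
    | succ j ih =>
      intro hj
      refine ih (step _ (by rw [smul_comm, hc']) ?_)
      rwa [smul_smul, ← pow_succ']
  exact down n (by rw [Module.mem_annihilator.1 hn]; exact zero_mem _)

/-- The counterpart of `ker_sub_one_eq_range_geom_sum` in degree `-1`. -/
theorem ker_geom_sum_eq_range_sub_one [Finite M] {p k : ℕ} (hp : p.Prime)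
    (hM : Nat.card M = p ^ k) {g h : R} (hg : g ^ p = 1) (hh : h ^ p = 1)
    (hnorm : ∀ m : M, g • m = m → h • m = m →
      ∃ n : M, (∑ i ∈ range p, g ^ i) • (∑ i ∈ range p, h ^ i) • n = m) :
    LinearMap.ker (LinearMap.lsmul R M (∑ i ∈ range p, g ^ i)) =
      LinearMap.range (LinearMap.lsmul R M (g - 1)) := by
  refine LinearMap.ker_eq_range_of_ker_eq_range ?_
    (ker_sub_one_eq_range_geom_sum hp hM hg hh hnorm)
  rintro _ ⟨n, rfl⟩
  rw [LinearMap.mem_ker, LinearMap.lsmul_apply, LinearMap.lsmul_apply, smul_smul,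
    geom_sum_mul, hg, sub_self, zero_smul]

/-! ### Norms and fixed points of subgroups -/

section SubgroupNorm

variable {Q R : Type*} [CommGroup Q] [CommRing R] (f : Q →* R)

/-- The norm element of a subgroup `K` with respect to a monoid homomorphism `f` into a ring: the
sum of `f q` over `q ∈ K`. -/
noncomputable def subgroupNorm [Finite Q] (K : Subgroup Q) : R :=
  letI := Fintype.ofFinite K
  ∑ q : K, f q

theorem subgroupNorm_eq_sum [Finite Q] (K : Subgroup Q) [Fintype K] :
    subgroupNorm f K = ∑ q : K, f q := by
  unfold subgroupNorm
  congr!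

theorem subgroupNorm_sup [Finite Q] {H K : Subgroup Q} (hd : Disjoint H K) :
    subgroupNorm f (H ⊔ K) = subgroupNorm f H * subgroupNorm f K := by
  have := Fintype.ofFinite H
  have := Fintype.ofFinite K
  have := Fintype.ofFinite ↥(H ⊔ K)
  rw [subgroupNorm_eq_sum, subgroupNorm_eq_sum, subgroupNorm_eq_sum, sum_mul_sum,
    ← Fintype.sum_prod_type']
  symm
  refine Fintype.sum_bijective (fun x : H × K => (⟨x.1 * x.2, Subgroup.mul_mem_sup x.1.2 x.2.2⟩ :
    ↥(H ⊔ K))) ⟨fun x y hxy => ?_, fun z => ?_⟩ _ _ fun x => (map_mul f _ _).symm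
  · exact Subgroup.mul_injective_of_disjoint hd (congrArg Subtype.val hxy)
  · obtain ⟨a, ha, b, hb, hab⟩ := Subgroup.mem_sup.1 z.2
    exact ⟨(⟨a, ha⟩, ⟨b, hb⟩), Subtype.ext hab⟩

theorem subgroupNorm_zpowers [Finite Q] {p : ℕ} {g : Q} (hg : orderOf g = p) :
    subgroupNorm f (Subgroup.zpowers g) = ∑ i ∈ range p, f g ^ i := by
  have := Fintype.ofFinite (Subgroup.zpowers g)
  subst hg
  rw [subgroupNorm_eq_sum, ← Fin.sum_univ_eq_sum_range]
  symm
  refine Fintype.sum_equiv (finEquivZPowers (isOfFinOrder_of_finite g)) _ _ fun i => ?_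
  simp [finEquivZPowers_apply]

theorem disjoint_zpowers_of_notMem {p : ℕ} (hp : p.Prime) {K : Subgroup Q} {g : Q}
    (hg : orderOf g = p) (hK : g ∉ K) : Disjoint K (Subgroup.zpowers g) := by
  have hcard : Nat.card (Subgroup.zpowers g) = p := by rw [Nat.card_zpowers, hg]
  have : Fact (Nat.card (Subgroup.zpowers g)).Prime := ⟨hcard ▸ hp⟩
  rcases (K.subgroupOf (Subgroup.zpowers g)).eq_bot_or_eq_top_of_prime_card with h | h
  · exact Subgroup.subgroupOf_eq_bot.1 h
  · exact absurd (Subgroup.subgroupOf_eq_top.1 h (Subgroup.mem_zpowers g)) hK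

theorem subgroupNorm_sup_zpowers [Finite Q] {p : ℕ} (hp : p.Prime) {K : Subgroup Q} {g : Q}
    (hg : orderOf g = p) (hK : g ∉ K) :
    subgroupNorm f (K ⊔ Subgroup.zpowers g) = subgroupNorm f K * ∑ i ∈ range p, f g ^ i := by
  rw [subgroupNorm_sup f (disjoint_zpowers_of_notMem hp hg hK), subgroupNorm_zpowers f hg]

variable {M : Type*} [AddCommGroup M] [Module R M]

/-- The submodule of elements fixed by a subgroup `K` acting through `f`. -/
def fixedBy (M : Type*) [AddCommGroup M] [Module R M] (K : Subgroup Q) : Submodule R M where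
  carrier := {m | ∀ q ∈ K, f q • m = m}
  add_mem' ha hb q hq := by rw [smul_add, ha q hq, hb q hq]
  zero_mem' q _ := smul_zero _
  smul_mem' r m hm q hq := by rw [smul_comm, hm q hq]

variable {f} in
theorem fixedBy_anti {H K : Subgroup Q} (h : H ≤ K) : fixedBy f M K ≤ fixedBy f M H :=
  fun _ hm q hq => hm q (h hq)

theorem mem_fixedBy_sup_zpowers {K : Subgroup Q} {g : Q} {m : M} :
    m ∈ fixedBy f M (K ⊔ Subgroup.zpowers g) ↔ m ∈ fixedBy f M K ∧ f g • m = m := by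
  refine ⟨fun h => ⟨fixedBy_anti le_sup_left h,
    h g (Subgroup.mem_sup_right (Subgroup.mem_zpowers g))⟩,
    fun ⟨hK, hg⟩ => ?_⟩
  -- the stabilizer of `m` is a subgroup
  let St : Subgroup Q :=
    { carrier := {q | f q • m = m}
      one_mem' := by simp
      mul_mem' := fun {a b} ha hb => by
        change f (a * b) • m = m
        rw [map_mul, mul_smul, hb, ha]
      inv_mem' := fun {a} ha => by
        change f a⁻¹ • m = m
        have ha' : f a • m = m := ha
        conv_lhs => rw [← ha']
        rw [smul_smul, ← map_mul, inv_mul_cancel, map_one, one_smul] }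
  exact fun q hq => (sup_le (show K ≤ St from hK) ((Subgroup.zpowers_le (H := St)).2 hg)) hq

theorem subgroupNorm_smul_mem_fixedBy [Finite Q] (K : Subgroup Q) (m : M) :
    subgroupNorm f K • m ∈ fixedBy f M K := by
  intro q hq
  have := Fintype.ofFinite K
  rw [subgroupNorm_eq_sum, smul_smul, mul_sum]
  congr 1
  exact Fintype.sum_equiv (Equiv.mulLeft (⟨q, hq⟩ : K)) _ _ fun x => (map_mul f _ _).symm

/-- The norm of `Q` is the norm of a subgroup `K` followed by a sum over coset representatives. -/
theorem exists_subgroupNorm_top_eq_mul [Finite Q] (K : Subgroup Q) :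
    ∃ T : R, subgroupNorm f ⊤ = T * subgroupNorm f K ∧
      ∀ (M : Type _) [AddCommGroup M] [Module R M] (m : M),
        m ∈ fixedBy f M K → T • m ∈ fixedBy f M ⊤ := by
  have := Fintype.ofFinite K
  have := Fintype.ofFinite Q
  have := Fintype.ofFinite (Q ⧸ K)
  have := Fintype.ofFinite (⊤ : Subgroup Q)
  refine ⟨∑ t : Q ⧸ K, f t.out, ?_, ?_⟩
  · rw [subgroupNorm_eq_sum, subgroupNorm_eq_sum, sum_mul_sum, ← Fintype.sum_prod_type']
    symm
    refine Fintype.sum_bijective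
      (fun x : (Q ⧸ K) × K => (⟨x.1.out * x.2, trivial⟩ : (⊤ : Subgroup Q)))
      ⟨?_, fun z => ?_⟩ _ _ fun x => (map_mul f _ _).symm
    · rintro ⟨t, k⟩ ⟨t', k'⟩ h
      have h' : t.out * k = t'.out * k' := congrArg Subtype.val h
      have ht : t = t' := by
        have := congrArg (QuotientGroup.mk (s := K)) h'
        rwa [QuotientGroup.mk_mul_of_mem _ k.2, QuotientGroup.mk_mul_of_mem _ k'.2,
          QuotientGroup.out_eq', QuotientGroup.out_eq'] at this
      subst ht
      exact Prod.ext rfl (Subtype.ext (mul_left_cancel h'))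
    · obtain ⟨k, hk⟩ := QuotientGroup.mk_out_eq_mul K (z : Q)
      refine ⟨((z : Q), k⁻¹), Subtype.ext ?_⟩
      change (Quotient.out ((z : Q) : Q ⧸ K)) * ((k⁻¹ : K) : Q) = z
      rw [hk]
      simp
  · intro M _ _ m hm q _
    rw [sum_smul, smul_sum]
    refine Fintype.sum_equiv (MulAction.toPerm q) _ _ fun t => ?_
    obtain ⟨k, hk⟩ := QuotientGroup.mk_out_eq_mul K (q * t.out)
    have ht : q • t = ((q * t.out : Q) : Q ⧸ K) := by
      conv_lhs => rw [← QuotientGroup.out_eq' t]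
      rfl
    rw [MulAction.toPerm_apply, ht, hk, map_mul, map_mul, mul_smul, hm k k.2, mul_smul]

end SubgroupNorm

/-! ### Fixed points under an elementary abelian group with trivial degree-zero cohomology -/

section ElementaryAbelian

variable {Q R M : Type*} [CommGroup Q] [CommRing R] {f : Q →* R} [AddCommGroup M]
  [Module R M] {p k : ℕ}

theorem orderOf_eq_prime_of_notMem (hp : p.Prime) (hQ : ∀ q : Q, q ^ p = 1) {K : Subgroup Q}
    {g : Q} (hg : g ∉ K) : orderOf g = p :=
  have := Fact.mk hp
  orderOf_eq_prime (hQ g) (ne_of_mem_of_not_mem K.one_mem hg).symm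

/-- An element outside `K` acts nontrivially on the elements fixed by `K`. -/
theorem exists_mem_fixedBy_smul_ne [Finite Q] (hp : p.Prime) (hQ : ∀ q : Q, q ^ p = 1)
    (hM : Nat.card M = p ^ k) (hfix : fixedBy f M ⊤ ≠ ⊥)
    (hnorm : ∀ m ∈ fixedBy f M ⊤, ∃ n : M, subgroupNorm f ⊤ • n = m)
    {K : Subgroup Q} {g : Q} (hg : g ∉ K) : ∃ m ∈ fixedBy f M K, f g • m ≠ m := by
  obtain ⟨j, hj⟩ := (fixedBy f M K).exists_card_eq_prime_pow hp hM
  obtain ⟨T, hT, hTfix⟩ := exists_subgroupNorm_top_eq_mul f (K ⊔ Subgroup.zpowers g)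
  rw [subgroupNorm_sup_zpowers f hp (orderOf_eq_prime_of_notMem hp hQ hg) hg] at hT
  suffices h : ∃ x : fixedBy f M K, f g • x ≠ x by
    obtain ⟨⟨m, hm⟩, hne⟩ := h
    exact ⟨m, hm, fun h => hne (Subtype.ext h)⟩
  refine exists_smul_ne_of_norm hj (S := T)
    (F := (fixedBy f M ⊤).comap (fixedBy f M K).subtype) ?_ ?_ ?_
  · obtain ⟨m, hm, h0⟩ := Submodule.exists_mem_ne_zero_of_ne_bot hfix
    refine Submodule.ne_bot_iff _ |>.2 ⟨⟨m, fixedBy_anti le_top hm⟩, hm, fun h => h0 ?_⟩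
    exact congrArg Subtype.val h
  · rintro ⟨m, hmK⟩ hm
    obtain ⟨n, hn⟩ := hnorm m hm
    refine ⟨⟨_, subgroupNorm_smul_mem_fixedBy f K n⟩, Subtype.ext ?_⟩
    change T • (∑ i ∈ range p, f g ^ i) • subgroupNorm f K • n = m
    rw [← hn, hT, smul_smul, smul_smul]
    congr 1
    ring
  · rintro ⟨m, hmK⟩ hm
    exact hTfix M m ((mem_fixedBy_sup_zpowers f).2 ⟨hmK, congrArg Subtype.val hm⟩)

theorem prime_mul_card_fixedBy_top_le [Finite M] [Finite Q] (hp : p.Prime)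
    (hQ : ∀ q : Q, q ^ p = 1)
    (hM : Nat.card M = p ^ k) (hfix : fixedBy f M ⊤ ≠ ⊥)
    (hnorm : ∀ m ∈ fixedBy f M ⊤, ∃ n : M, subgroupNorm f ⊤ • n = m)
    {K : Subgroup Q} {g : Q} (hg : g ∉ K) :
    p * Nat.card (fixedBy f M ⊤) ≤ Nat.card (fixedBy f M K) := by
  obtain ⟨m, hm, hne⟩ := exists_mem_fixedBy_smul_ne hp hQ hM hfix hnorm hg
  refine Submodule.prime_mul_card_le_of_lt hp hM
    (lt_of_le_of_ne (fixedBy_anti le_top) fun h => hne ?_)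
  rw [← h] at hm
  exact hm g trivial

/-- Two successive independent elements `g`, `h` outside `K` force the fixed points of `K` to exceed
those of `K ⊔ ⟨g⟩` by a factor of at least `p ^ p`. -/
theorem prime_pow_mul_card_fixedBy_sup_le [Finite M] [Finite Q] (hp : p.Prime)
    (hQ : ∀ q : Q, q ^ p = 1)
    (hM : Nat.card M = p ^ k) (hfix : fixedBy f M ⊤ ≠ ⊥)
    (hnorm : ∀ m ∈ fixedBy f M ⊤, ∃ n : M, subgroupNorm f ⊤ • n = m)
    {K : Subgroup Q} {g h : Q} (hg : g ∉ K) (hh : h ∉ K ⊔ Subgroup.zpowers g) :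
    p ^ p * Nat.card (fixedBy f M (K ⊔ Subgroup.zpowers g)) ≤ Nat.card (fixedBy f M K) := by
  obtain ⟨j, hj⟩ := (fixedBy f M K).exists_card_eq_prime_pow hp hM
  obtain ⟨T, hT, hTfix⟩ :=
    exists_subgroupNorm_top_eq_mul f (K ⊔ Subgroup.zpowers g ⊔ Subgroup.zpowers h)
  rw [subgroupNorm_sup_zpowers f hp (orderOf_eq_prime_of_notMem hp hQ hh) hh,
    subgroupNorm_sup_zpowers f hp (orderOf_eq_prime_of_notMem hp hQ hg) hg] at hT
  have hpow : ∀ q, f q ^ p = 1 := fun q => by rw [← map_pow, hQ, map_one]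
  have hker : Nat.card (LinearMap.ker (LinearMap.lsmul R (fixedBy f M K) (f g - 1))) =
      Nat.card (fixedBy f M (K ⊔ Subgroup.zpowers g)) := by
    have hmem : ∀ x : fixedBy f M K,
        x ∈ LinearMap.ker (LinearMap.lsmul R (fixedBy f M K) (f g - 1)) ↔ f g • (x : M) = x := by
      intro x
      rw [LinearMap.mem_ker, LinearMap.lsmul_apply, sub_smul, one_smul, sub_eq_zero]
      exact Subtype.ext_iff
    refine Nat.card_congr
      { toFun := fun x => ⟨x, (mem_fixedBy_sup_zpowers f).2 ⟨x.1.2, (hmem _).1 x.2⟩⟩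
        invFun := fun x => ⟨⟨x, ((mem_fixedBy_sup_zpowers f).1 x.2).1⟩,
          (hmem _).2 ((mem_fixedBy_sup_zpowers f).1 x.2).2⟩
        left_inv := fun _ => rfl
        right_inv := fun _ => rfl }
  rw [← hker]
  refine prime_pow_mul_card_ker_le hp hj (hpow g) (hpow h) (S := T)
    (F := (fixedBy f M ⊤).comap (fixedBy f M K).subtype) ?_ ?_ ?_
  · obtain ⟨m, hm, h0⟩ := Submodule.exists_mem_ne_zero_of_ne_bot hfix
    refine Submodule.ne_bot_iff _ |>.2 ⟨⟨m, fixedBy_anti le_top hm⟩, hm, fun h => h0 ?_⟩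
    exact congrArg Subtype.val h
  · rintro ⟨m, hmK⟩ hm
    obtain ⟨n, hn⟩ := hnorm m hm
    refine ⟨⟨_, subgroupNorm_smul_mem_fixedBy f K n⟩, Subtype.ext ?_⟩
    change T • (∑ i ∈ range p, f g ^ i) • (∑ i ∈ range p, f h ^ i) • subgroupNorm f K • n = m
    rw [← hn, hT, smul_smul, smul_smul, smul_smul]
    congr 1
    ring
  · rintro ⟨m, hmK⟩ hmg hmh
    exact hTfix M m ((mem_fixedBy_sup_zpowers f).2
      ⟨(mem_fixedBy_sup_zpowers f).2 ⟨hmK, congrArg Subtype.val hmg⟩, congrArg Subtype.val hmh⟩)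

end ElementaryAbelian

/-! ### The Frattini quotient of a `p`-group -/

section Frattini

variable {G : Type*} [Group G] {p : ℕ}

theorem mem_frattini_iff {g : G} : g ∈ frattini G ↔ ∀ K : Subgroup G, IsCoatom K → g ∈ K := by
  simp [frattini, Order.radical, Subgroup.mem_iInf]

variable [Finite G]

/-- A maximal subgroup of a finite `p`-group is normal, with quotient generated by an element of
order `p`. -/
theorem IsPGroup.exists_zpowers_eq_top_of_isCoatom [Fact p.Prime] (hG : IsPGroup p G)
    {K : Subgroup G} (hK : IsCoatom K) [K.Normal] :
    ∃ z : G ⧸ K, orderOf z = p ∧ Subgroup.zpowers z = ⊤ := by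
  have hne : Nontrivial (G ⧸ K) := by
    rw [← not_subsingleton_iff_nontrivial, QuotientGroup.subsingleton_iff]
    exact hK.1
  obtain ⟨n, hn, hcard⟩ := (hG.to_quotient K).nontrivial_iff_card.1 hne
  obtain ⟨z, hz⟩ := exists_prime_orderOf_dvd_card' (G := G ⧸ K) p
    (hcard ▸ dvd_pow_self p hn.ne')
  refine ⟨z, hz, ?_⟩
  have hlt : K < (Subgroup.zpowers z).comap (QuotientGroup.mk' K) := by
    refine lt_of_le_of_ne (fun x hx => ?_) fun h => ?_
    · rw [Subgroup.mem_comap, QuotientGroup.mk'_apply, (QuotientGroup.eq_one_iff x).2 hx]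
      exact one_mem _
    · obtain ⟨y, rfl⟩ := QuotientGroup.mk'_surjective K z
      have hy : y ∈ K := by
        rw [h]
        exact Subgroup.mem_zpowers _
      rw [QuotientGroup.mk'_apply, (QuotientGroup.eq_one_iff y).2 hy, orderOf_one] at hz
      exact (Fact.out : p.Prime).one_lt.ne hz
  have htop := hK.2 _ hlt
  rw [← Subgroup.comap_top (QuotientGroup.mk' K)] at htop
  exact Subgroup.comap_injective (QuotientGroup.mk'_surjective K) htop

theorem IsPGroup.normal_of_isCoatom [Fact p.Prime] (hG : IsPGroup p G) {K : Subgroup G}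
    (hK : IsCoatom K) : K.Normal :=
  have := hG.isNilpotent
  Subgroup.NormalizerCondition.normal_of_coatom K Group.normalizerCondition_of_isNilpotent hK

theorem IsPGroup.pow_mem_frattini [Fact p.Prime] (hG : IsPGroup p G) (g : G) :
    g ^ p ∈ frattini G := by
  refine mem_frattini_iff.2 fun K hK => ?_
  have := hG.normal_of_isCoatom hK
  obtain ⟨z, hz, htop⟩ := hG.exists_zpowers_eq_top_of_isCoatom hK
  obtain ⟨i, hi⟩ := Subgroup.mem_zpowers_iff.1 (htop ▸ Subgroup.mem_top (g : G ⧸ K))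
  rw [← QuotientGroup.eq_one_iff, QuotientGroup.mk_pow, ← hi, ← zpow_natCast, ← zpow_mul, mul_comm,
    zpow_mul, zpow_natCast, ← hz, pow_orderOf_eq_one, one_zpow]

theorem IsPGroup.quotient_frattini_mul_comm [Fact p.Prime] (hG : IsPGroup p G)
    (a b : G ⧸ frattini G) : a * b = b * a := by
  induction a using QuotientGroup.induction_on with | _ a
  induction b using QuotientGroup.induction_on with | _ b
  rw [← QuotientGroup.mk_mul, ← QuotientGroup.mk_mul, QuotientGroup.eq]
  refine mem_frattini_iff.2 fun K hK => ?_
  have := hG.normal_of_isCoatom hK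
  obtain ⟨z, hz, htop⟩ := hG.exists_zpowers_eq_top_of_isCoatom hK
  obtain ⟨i, hi⟩ := Subgroup.mem_zpowers_iff.1 (htop ▸ Subgroup.mem_top (a : G ⧸ K))
  obtain ⟨j, hj⟩ := Subgroup.mem_zpowers_iff.1 (htop ▸ Subgroup.mem_top (b : G ⧸ K))
  rw [← QuotientGroup.eq, QuotientGroup.mk_mul, QuotientGroup.mk_mul, ← hi, ← hj, ← zpow_add,
    ← zpow_add, add_comm]

/-- In a `p`-group a strict inclusion of subgroups increases the order at least `p`-fold. -/
theorem IsPGroup.prime_mul_card_le_of_lt (hp : p.Prime) (hG : IsPGroup p G) {H K : Subgroup G}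
    (h : H < K) : p * Nat.card H ≤ Nat.card K := by
  have := Fact.mk hp
  obtain ⟨i, hi⟩ := IsPGroup.iff_card.1 (hG.to_subgroup H)
  obtain ⟨j, hj⟩ := IsPGroup.iff_card.1 (hG.to_subgroup K)
  have hlt : Nat.card H < Nat.card K :=
    Set.ncard_lt_ncard (s := (H : Set G)) (t := (K : Set G)) h
  rw [hi, hj] at *
  rw [← pow_succ']
  exact Nat.pow_le_pow_right hp.pos ((Nat.pow_lt_pow_iff_right hp.one_lt).1 hlt)

end Frattini

/-! ### Commuting generators modulo an abelian normal subgroup -/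

section Splitting

variable {G Q R M : Type*} [Group G] [Group Q] [CommRing R] [AddCommGroup M] [Module R M]
  {π : G →* Q} {f : Q →* R} {ι : M → G}

theorem map_zero_of_map_add (hadd : ∀ a b, ι (a + b) = ι a * ι b) : ι 0 = 1 := by
  have := hadd 0 0
  rwa [add_zero, left_eq_mul] at this

/-- Powers of `x` translated by an element of an abelian normal subgroup are governed by partial
norms of `x`. -/
theorem mul_pow_eq_geom_sum (hadd : ∀ a b, ι (a + b) = ι a * ι b)
    (hact : ∀ x a, ι (f (π x) • a) = x * ι a * x⁻¹) (u : M) (x : G) (n : ℕ) :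
    (ι u * x) ^ n = ι ((∑ i ∈ range n, f (π x) ^ i) • u) * x ^ n := by
  induction n with
  | zero => simp [map_zero_of_map_add hadd]
  | succ n ih =>
    rw [pow_succ', ih, geom_sum_succ, add_smul, one_smul, mul_smul, add_comm, hadd, hact, pow_succ']
    group

/-- Let `x`, `y` generate `G` modulo an abelian normal subgroup on which `⟨x⟩` has trivial Tate
cohomology in degrees `0` and `-1`. Degree `0` allows one to make `x ^ p = 1`; then the norm of the
commutator vanishes, and degree `-1` allows one to make `x` and `y` commute. -/
theorem exists_commuting_lifts {p : ℕ} (hadd : ∀ a b, ι (a + b) = ι a * ι b)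
    (hinj : Function.Injective ι) (hact : ∀ x a, ι (f (π x) • a) = x * ι a * x⁻¹)
    (hker : ∀ a, π (ι a) = 1) (hsurj : ∀ z, π z = 1 → ∃ a, ι a = z) {x y : G}
    (hx : π x ^ p = 1) (hxy : π x * π y = π y * π x)
    (h0 : LinearMap.ker (LinearMap.lsmul R M (f (π x) - 1)) =
      LinearMap.range (LinearMap.lsmul R M (∑ i ∈ range p, f (π x) ^ i)))
    (h1 : LinearMap.ker (LinearMap.lsmul R M (∑ i ∈ range p, f (π x) ^ i)) =
      LinearMap.range (LinearMap.lsmul R M (f (π x) - 1))) :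
    ∃ x' y' : G, π x' = π x ∧ π y' = π y ∧ x' * y' = y' * x' := by
  have hzero := map_zero_of_map_add hadd
  have hneg : ∀ a, ι (-a) = (ι a)⁻¹ := fun a =>
    eq_inv_of_mul_eq_one_left (by rw [← hadd, neg_add_cancel, hzero])
  -- adjust `x` to have order `p`
  obtain ⟨a, ha⟩ := hsurj (x ^ p) (by rw [map_pow, hx])
  have hafix : -a ∈ LinearMap.ker (LinearMap.lsmul R M (f (π x) - 1)) := by
    rw [LinearMap.mem_ker, LinearMap.lsmul_apply, smul_neg, neg_eq_zero, sub_smul, one_smul,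
      sub_eq_zero]
    apply hinj
    rw [hact, ha, ← pow_succ', pow_succ, mul_inv_cancel_right]
  rw [h0] at hafix
  obtain ⟨u, hu⟩ := hafix
  rw [LinearMap.lsmul_apply] at hu
  set x' := ι u * x with hx'
  have hpx : π x' = π x := by rw [hx', map_mul, hker, one_mul]
  have hx'p : x' ^ p = 1 := by
    rw [hx', mul_pow_eq_geom_sum hadd hact, hu, hneg, ha, inv_mul_cancel]
  -- adjust `y` to commute with `x'`
  obtain ⟨c, hc⟩ := hsurj (y * x' * y⁻¹ * x'⁻¹) (by
    rw [map_mul, map_mul, map_mul, map_inv, map_inv, hpx, ← hxy]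
    group)
  have hcN : c ∈ LinearMap.ker (LinearMap.lsmul R M (∑ i ∈ range p, f (π x) ^ i)) := by
    rw [LinearMap.mem_ker, LinearMap.lsmul_apply]
    apply hinj
    have hconj : ι c * x' = y * x' * y⁻¹ := by rw [hc]; group
    have := mul_pow_eq_geom_sum hadd hact c x' p
    rw [hconj, conj_pow, hx'p, mul_one, mul_one, mul_inv_cancel, hpx] at this
    rw [← this, hzero]
  rw [h1] at hcN
  obtain ⟨w, hw⟩ := hcN
  rw [LinearMap.lsmul_apply, sub_smul, one_smul, sub_eq_iff_eq_add] at hw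
  refine ⟨x', ι w * y, hpx, by rw [map_mul, hker, one_mul], ?_⟩
  have hw' : x' * ι w * x'⁻¹ = y * x' * y⁻¹ * x'⁻¹ * ι w := by
    rw [← hact, hpx, hw, hadd, hc]
  have hcomm : y * x' * y⁻¹ * x'⁻¹ * ι w = ι w * (y * x' * y⁻¹ * x'⁻¹) := by
    rw [← hc, ← hadd, ← hadd, add_comm]
  rw [hcomm, mul_inv_eq_iff_eq_mul] at hw'
  rw [← mul_assoc, hw']
  group

end Splitting

/-! ### Orders of the center and of `Z(Φ(G))` -/

section Core

variable {G Q R M : Type*} [Group G] [CommGroup Q] [CommRing R]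
  [AddCommGroup M] [Module R M] {p k : ℕ}

/-- A nonzero module of `p`-power order over a finite elementary abelian `p`-group has nonzero fixed
points: the augmentation ideal annihilates every simple submodule. -/
theorem fixedBy_top_ne_bot [Finite Q] [Finite M] [Nontrivial M] (hp : p.Prime)
    (hQ : ∀ q : Q, q ^ p = 1)
    (hM : Nat.card M = p ^ k) (f : Q →* R) : fixedBy f M ⊤ ≠ ⊥ := by
  obtain ⟨N, hN, -⟩ := (eq_bot_or_exists_atom_le (⊤ : Submodule R M)).resolve_left top_ne_bot
  set I : Ideal R := Ideal.span (Set.range fun q => f q - 1)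
  have hlt : I • N < N := by
    refine Submodule.smul_lt_of_le_radical_annihilator (Submodule.fg_span (Set.finite_range _))
      (Ideal.span_le.2 ?_) hN.1
    rintro _ ⟨q, rfl⟩
    exact sub_one_mem_radical_annihilator hp hM (by rw [← map_pow, hQ, map_one])
  have hbot := hN.2 _ hlt
  obtain ⟨m, hm, h0⟩ := Submodule.exists_mem_ne_zero_of_ne_bot hN.1
  refine (Submodule.ne_bot_iff _).2 ⟨m, fun q _ => ?_, h0⟩
  have : (f q - 1) • m ∈ I • N := Submodule.smul_mem_smul (Ideal.subset_span ⟨q, rfl⟩) hm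
  rwa [hbot, Submodule.mem_bot, sub_smul, one_smul, sub_eq_zero] at this

variable {π : G →* Q} {f : Q →* R} {ι : M → G}

/-- A set generating `G` modulo the Frattini subgroup generates `G`. -/
theorem closure_eq_top_of_map_eq_top [Finite G] (hker : π.ker = frattini G) {S : Set G}
    (h : (Subgroup.closure S).map π = ⊤) : Subgroup.closure S = ⊤ := by
  refine frattini_nongenerating ?_
  rw [← hker, ← Subgroup.comap_map_eq, h, Subgroup.comap_top]

theorem mul_comm_of_closure_pair_eq_top {x y : G} (hxy : x * y = y * x)
    (h : Subgroup.closure {x, y} = ⊤) (a b : G) : a * b = b * a := by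
  have hc : ∀ u ∈ ({x, y} : Set G), ∀ v ∈ ({x, y} : Set G), u * v = v * u := by
    rintro u (rfl | rfl) v (rfl | rfl)
    exacts [rfl, hxy, hxy.symm, rfl]
  have := Subgroup.isMulCommutative_closure hc
  have ha : a ∈ Subgroup.closure {x, y} := h ▸ Subgroup.mem_top a
  have hb : b ∈ Subgroup.closure {x, y} := h ▸ Subgroup.mem_top b
  exact congrArg Subtype.val (mul_comm' (⟨a, ha⟩ : Subgroup.closure {x, y}) ⟨b, hb⟩)

theorem map_closure_pair (x y : G) :
    (Subgroup.closure {x, y}).map π = Subgroup.zpowers (π x) ⊔ Subgroup.zpowers (π y) := by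
  rw [MonoidHom.map_closure, Set.image_pair, Subgroup.zpowers_eq_closure,
    Subgroup.zpowers_eq_closure, ← Subgroup.closure_union, Set.singleton_union]

theorem zpowers_ne_top [Finite G] (hker : π.ker = frattini G) (hπ : Function.Surjective π)
    (hnonab : ∃ a b : G, a * b ≠ b * a) (g : Q) : Subgroup.zpowers g ≠ ⊤ := by
  intro htop
  obtain ⟨x, rfl⟩ := hπ g
  obtain ⟨a, b, hab⟩ := hnonab
  refine hab (mul_comm_of_closure_pair_eq_top (x := x) (y := x) rfl
    (closure_eq_top_of_map_eq_top hker ?_) a b)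
  rw [map_closure_pair, htop, sup_idem]

/-- `G/Φ(G)` acts faithfully on `Z(Φ(G))`, so the center of `G` lies in `Φ(G)`. -/
theorem center_le_frattini [Finite Q] (hp : p.Prime) (hQ : ∀ q : Q, q ^ p = 1)
    (hker : π.ker = frattini G)
    (hinj : Function.Injective ι) (hact : ∀ x a, ι (f (π x) • a) = x * ι a * x⁻¹)
    (hM : Nat.card M = p ^ k) (hfix : fixedBy f M ⊤ ≠ ⊥)
    (hnorm : ∀ m ∈ fixedBy f M ⊤, ∃ n : M, subgroupNorm f ⊤ • n = m) :
    Subgroup.center G ≤ frattini G := by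
  intro x hx
  by_contra hxΦ
  have hπx : π x ∉ (⊥ : Subgroup Q) := by rwa [Subgroup.mem_bot, ← MonoidHom.mem_ker, hker]
  obtain ⟨m, -, hne⟩ := exists_mem_fixedBy_smul_ne hp hQ hM hfix hnorm hπx
  refine hne (hinj ?_)
  rw [hact, ← Subgroup.mem_center_iff.1 hx, mul_inv_cancel_right]

/-- Once `Z(G) ≤ Φ(G)`, the center of `G` is the set of fixed points of `G/Φ(G)` on `Z(Φ(G))`. -/
theorem card_center_eq_card_fixedBy (hπ : Function.Surjective π)
    (hinj : Function.Injective ι) (hact : ∀ x a, ι (f (π x) • a) = x * ι a * x⁻¹)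
    (hrange : ∀ z, (∃ a, ι a = z) ↔ z ∈ frattini G ∧ ∀ w ∈ frattini G, w * z = z * w)
    (hle : Subgroup.center G ≤ frattini G) :
    Nat.card (Subgroup.center G) = Nat.card (fixedBy f M ⊤) := by
  symm
  refine Nat.card_congr (Equiv.ofBijective (fun m => ⟨ι m, ?_⟩) ⟨fun m n h => ?_, fun z => ?_⟩)
  · refine Subgroup.mem_center_iff.2 fun x => ?_
    rw [← mul_inv_eq_iff_eq_mul, ← hact, m.2 (π x) trivial]
  · exact Subtype.ext (hinj (congrArg Subtype.val h))
  · obtain ⟨a, ha⟩ := (hrange z).2 ⟨hle z.2, fun w _ => Subgroup.mem_center_iff.1 z.2 w⟩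
    refine ⟨⟨a, fun q _ => ?_⟩, Subtype.ext ha⟩
    obtain ⟨x, rfl⟩ := hπ q
    apply hinj
    rw [hact, ha, Subgroup.mem_center_iff.1 z.2, mul_inv_cancel_right]

/-- In the two-generator case `Φ(G)` is not abelian: otherwise generators could be chosen to
commute. -/
theorem exists_frattini_not_commute [Finite M] [Finite G] [Finite Q] (hp : p.Prime)
    (hQ : ∀ q : Q, q ^ p = 1)
    (hπ : Function.Surjective π) (hker : π.ker = frattini G)
    (hadd : ∀ a b, ι (a + b) = ι a * ι b)
    (hinj : Function.Injective ι) (hact : ∀ x a, ι (f (π x) • a) = x * ι a * x⁻¹)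
    (hrange : ∀ z, (∃ a, ι a = z) ↔ z ∈ frattini G ∧ ∀ w ∈ frattini G, w * z = z * w)
    (hM : Nat.card M = p ^ k)
    (hnorm : ∀ m ∈ fixedBy f M ⊤, ∃ n : M, subgroupNorm f ⊤ • n = m)
    (hnonab : ∃ a b : G, a * b ≠ b * a) {g h : Q} (hg : g ≠ 1) (hh : h ∉ Subgroup.zpowers g)
    (htop : Subgroup.zpowers g ⊔ Subgroup.zpowers h = ⊤) :
    ∃ z ∈ frattini G, ∃ w ∈ frattini G, w * z ≠ z * w := by
  by_contra! hab
  obtain ⟨x, rfl⟩ := hπ g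
  obtain ⟨y, rfl⟩ := hπ h
  have hpow : ∀ q, f q ^ p = 1 := fun q => by rw [← map_pow, hQ, map_one]
  have hN : ∀ m : M, f (π x) • m = m → f (π y) • m = m →
      ∃ n : M, (∑ i ∈ range p, f (π x) ^ i) • (∑ i ∈ range p, f (π y) ^ i) • n = m := by
    intro m hmx hmy
    have hmfix : m ∈ fixedBy f M ⊤ := by
      rw [← htop, mem_fixedBy_sup_zpowers]
      refine ⟨?_, hmy⟩
      rw [← bot_sup_eq (Subgroup.zpowers (π x)), mem_fixedBy_sup_zpowers]
      refine ⟨fun q hq => ?_, hmx⟩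
      rw [Subgroup.mem_bot.1 hq, map_one, one_smul]
    obtain ⟨n, rfl⟩ := hnorm m hmfix
    have hgp : orderOf (π x) = p :=
      orderOf_eq_prime_of_notMem hp hQ (K := ⊥) (by rwa [Subgroup.mem_bot])
    refine ⟨n, ?_⟩
    rw [← htop, subgroupNorm_sup_zpowers f hp (orderOf_eq_prime_of_notMem hp hQ hh) hh,
      subgroupNorm_zpowers f hgp, mul_smul]
  obtain ⟨x', y', hx', hy', hcomm⟩ := exists_commuting_lifts hadd hinj hact
    (fun a => by rw [← MonoidHom.mem_ker, hker]; exact ((hrange _).1 ⟨a, rfl⟩).1)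
    (fun z hz => by
      rw [← MonoidHom.mem_ker, hker] at hz
      exact (hrange z).2 ⟨hz, hab z hz⟩)
    (hQ _) (mul_comm _ _)
    (ker_sub_one_eq_range_geom_sum hp hM (hpow _) (hpow _) hN)
    (ker_geom_sum_eq_range_sub_one hp hM (hpow _) (hpow _) hN)
  obtain ⟨a, b, hne⟩ := hnonab
  refine hne (mul_comm_of_closure_pair_eq_top hcomm (closure_eq_top_of_map_eq_top hker ?_) a b)
  rw [map_closure_pair, hx', hy', htop]

theorem rank_eq_two [Finite G] (hπ : Function.Surjective π) (hker : π.ker = frattini G)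
    (hnonab : ∃ a b : G, a * b ≠ b * a) {g h : Q}
    (htop : Subgroup.zpowers g ⊔ Subgroup.zpowers h = ⊤) : Group.rank G = 2 := by
  classical
  obtain ⟨x, rfl⟩ := hπ g
  obtain ⟨y, rfl⟩ := hπ h
  refine le_antisymm ?_ ?_
  · refine (Group.rank_le (S := {x, y}) ?_).trans Finset.card_le_two
    rw [Finset.coe_pair]
    exact closure_eq_top_of_map_eq_top hker (by rw [map_closure_pair, htop])
  · by_contra! hlt
    obtain ⟨S, hS, hclos⟩ := Group.rank_spec G
    obtain ⟨u, hu⟩ := Finset.card_le_one_iff_subset_singleton.1 (show S.card ≤ 1 by omega)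
    obtain ⟨a, b, hne⟩ := hnonab
    refine hne (mul_comm_of_closure_pair_eq_top (x := u) (y := u) rfl (top_unique ?_) a b)
    rw [← hclos]
    refine Subgroup.closure_mono fun s hs => ?_
    have := Finset.mem_singleton.1 (hu hs)
    simp [this]

/-- The numerical conclusions for an abstract model of an NS-group: `π` is the projection to the
Frattini quotient `Q`, `ι` embeds `M` as `Z(Φ(G))`, and `Q` acts on `M` through `f` by
conjugation. -/
theorem rank_and_card_center_of_norm_eq_fixed [Finite G] [Finite Q] (hp : p.Prime)
    (hG : IsPGroup p G)
    (hQ : ∀ q : Q, q ^ p = 1) (hπ : Function.Surjective π) (hker : π.ker = frattini G)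
    (hadd : ∀ a b, ι (a + b) = ι a * ι b)
    (hinj : Function.Injective ι) (hact : ∀ x a, ι (f (π x) • a) = x * ι a * x⁻¹)
    (hrange : ∀ z, (∃ a, ι a = z) ↔ z ∈ frattini G ∧ ∀ w ∈ frattini G, w * z = z * w)
    (hcardM : Nat.card M = Nat.card (Subgroup.center (frattini G)))
    (hnorm : ∀ m ∈ fixedBy f M ⊤, ∃ n : M, subgroupNorm f ⊤ • n = m)
    (hnonab : ∃ a b : G, a * b ≠ b * a) (hcard : Nat.card G = p ^ (p + 6)) :
    Group.rank G = 2 ∧ Nat.card M = p ^ (p + 2) ∧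
      (IsCyclic (Subgroup.center G) ∧ Nat.card (Subgroup.center G) = p) := by
  have := Fact.mk hp
  have hfinM : Finite M := Finite.of_injective ι hinj
  have hΦp : IsPGroup p (frattini G) := hG.to_subgroup _
  have hQp : IsPGroup p Q := hG.of_surjective π hπ
  obtain ⟨k, hk⟩ := IsPGroup.iff_card.1 (hΦp.to_subgroup (Subgroup.center (frattini G)))
  have hM : Nat.card M = p ^ k := hcardM.trans hk
  have hcardQ : Nat.card Q * Nat.card (frattini G) = p ^ (p + 6) := by
    rw [← hcard, ← hker, Subgroup.card_eq_card_quotient_mul_card_subgroup π.ker,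
      Nat.card_congr (QuotientGroup.quotientKerEquivOfSurjective π hπ).toEquiv]
  have hMΦ : Nat.card M ≤ Nat.card (frattini G) := hcardM ▸ Subgroup.card_le_card_group _
  -- `Φ(G)` is nontrivial, for otherwise `G` embeds in the abelian group `Q`
  have hΦ : Nontrivial (frattini G) := by
    rw [Subgroup.nontrivial_iff_ne_bot]
    intro hbot
    obtain ⟨a, b, hne⟩ := hnonab
    refine hne ((MonoidHom.ker_eq_bot_iff π).1 (hker.trans hbot) ?_)
    rw [map_mul, map_mul, mul_comm]
  have hMnt : Nontrivial M := by
    have := hΦp.center_nontrivial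
    rw [← Finite.one_lt_card_iff_nontrivial, hcardM]
    exact Finite.one_lt_card
  have hfix : fixedBy f M ⊤ ≠ ⊥ := fixedBy_top_ne_bot hp hQ hM f
  have hF : p ≤ Nat.card (fixedBy f M ⊤) := by
    simpa using Submodule.prime_mul_card_le_of_lt hp hM (bot_lt_iff_ne_bot.2 hfix)
  have hcyc := zpowers_ne_top hker hπ hnonab
  have hle := center_le_frattini hp hQ hker hinj hact hM hfix hnorm
  have hZ := card_center_eq_card_fixedBy hπ hinj hact hrange hle
  obtain ⟨g, -, hg⟩ := SetLike.exists_of_lt ((hcyc 1).lt_top)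
  obtain ⟨h, -, hh⟩ := SetLike.exists_of_lt ((hcyc g).lt_top)
  have hg1 : g ≠ 1 := fun e => hg (e ▸ Subgroup.mem_zpowers _)
  have hgbot : g ∉ (⊥ : Subgroup Q) := by rwa [Subgroup.mem_bot]
  have hcardg : Nat.card (Subgroup.zpowers g) = p := by
    rw [Nat.card_zpowers, orderOf_eq_prime_of_notMem hp hQ hgbot]
  have hcardh : Nat.card (Subgroup.zpowers h) = p := by
    rw [Nat.card_zpowers, orderOf_eq_prime_of_notMem hp hQ hh]
  have hbound : p ^ p * Nat.card (fixedBy f M (Subgroup.zpowers g)) ≤ Nat.card M := by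
    have h1 := prime_pow_mul_card_fixedBy_sup_le hp hQ hM hfix hnorm hgbot
      (by rwa [bot_sup_eq] : h ∉ ⊥ ⊔ Subgroup.zpowers g)
    rw [bot_sup_eq] at h1
    exact h1.trans (Nat.card_le_card_of_injective _ Subtype.val_injective)
  have htop : Subgroup.zpowers g ⊔ Subgroup.zpowers h = ⊤ := by
    by_contra hne
    obtain ⟨w, -, hw⟩ := SetLike.exists_of_lt (Ne.lt_top hne)
    -- with three independent elements, `G` would have order at least `p ^ (2 * p + 5)`
    have h1 := prime_pow_mul_card_fixedBy_sup_le hp hQ hM hfix hnorm hh hw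
    have h2 := prime_mul_card_fixedBy_top_le hp hQ hM hfix hnorm hw
    have h3 : p * Nat.card (Subgroup.zpowers g) ≤ _ := hQp.prime_mul_card_le_of_lt hp
      (lt_of_le_of_ne le_sup_left fun e => hh (e ▸ Subgroup.mem_sup_right (Subgroup.mem_zpowers h)))
    have h4 := hQp.prime_mul_card_le_of_lt hp (Ne.lt_top hne)
    rw [Subgroup.card_top] at h4
    have hQ3 : p ^ 3 ≤ Nat.card Q :=
      calc p ^ 3 = p * (p * p) := by ring
        _ ≤ _ := (Nat.mul_le_mul_left p (hcardg ▸ h3)).trans h4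
    have hM3 : p ^ (2 * p + 2) ≤ Nat.card M :=
      calc p ^ (2 * p + 2) = p ^ p * (p ^ p * (p * p)) := by ring
        _ ≤ p ^ p * (p ^ p * (p * Nat.card (fixedBy f M ⊤))) := by gcongr
        _ ≤ _ := (Nat.mul_le_mul_left _ ((Nat.mul_le_mul_left _ h2).trans h1)).trans hbound
    have hle5 : p ^ (2 * p + 5) ≤ p ^ (p + 6) := by
      rw [← hcardQ]
      calc p ^ (2 * p + 5) = p ^ 3 * p ^ (2 * p + 2) := by ring
        _ ≤ _ := Nat.mul_le_mul hQ3 (hM3.trans hMΦ)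
    have := (Nat.pow_le_pow_iff_right hp.one_lt).1 hle5
    have := hp.two_le
    omega
  have hcardQ2 : Nat.card Q = p ^ 2 := by
    have hcompl : (Subgroup.zpowers g).IsComplement' (Subgroup.zpowers h) := by
      refine Subgroup.isComplement'_of_disjoint_and_mul_eq_univ
        (disjoint_zpowers_of_notMem hp (orderOf_eq_prime_of_notMem hp hQ hh) hh) ?_
      rw [← Subgroup.mul_normal, htop, Subgroup.coe_top]
    rw [← hcompl.card_mul_card, hcardg, hcardh, sq]
  have hcardΦ : Nat.card (frattini G) = p ^ (p + 4) := by
    rw [hcardQ2] at hcardQ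
    refine Nat.eq_of_mul_eq_mul_left (pow_pos hp.pos 2) (hcardQ.trans ?_)
    ring
  have hMlow : p ^ (p + 1) * Nat.card (fixedBy f M ⊤) ≤ p ^ k := by
    rw [← hM]
    calc p ^ (p + 1) * Nat.card (fixedBy f M ⊤)
        = p ^ p * (p * Nat.card (fixedBy f M ⊤)) := by ring
      _ ≤ _ := (Nat.mul_le_mul_left _
        (prime_mul_card_fixedBy_top_le hp hQ hM hfix hnorm hh)).trans hbound
  have hklow : p + 2 ≤ k := by
    refine (Nat.pow_le_pow_iff_right hp.one_lt).1 ?_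
    calc p ^ (p + 2) = p ^ (p + 1) * p := by ring
      _ ≤ _ := (Nat.mul_le_mul_left _ hF).trans hMlow
  -- if `Z(Φ(G))` had index at most `p` in `Φ(G)`, then `Φ(G)` would be abelian
  have hkup : k ≤ p + 2 := by
    by_contra! hlt
    have hidx := Subgroup.card_eq_card_quotient_mul_card_subgroup (Subgroup.center (frattini G))
    rw [hcardΦ, hk] at hidx
    have hdvd : Nat.card (frattini G ⧸ Subgroup.center (frattini G)) ∣ p := by
      refine (Nat.mul_dvd_mul_iff_right (pow_pos hp.pos k)).1 ?_
      rw [← hidx, ← pow_succ']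
      exact pow_dvd_pow p (by omega)
    have : IsCyclic (frattini G ⧸ Subgroup.center (frattini G)) := isCyclic_of_card_dvd_prime hdvd
    have hcomm := isMulCommutative_of_isCyclic_quotient_center_self (frattini G)
    obtain ⟨z, hz, w, hw, hne⟩ := exists_frattini_not_commute hp hQ hπ hker hadd hinj hact hrange
      hM hnorm hnonab hg1 hh htop
    exact hne (congrArg Subtype.val (mul_comm' (⟨w, hw⟩ : frattini G) ⟨z, hz⟩))
  obtain rfl : k = p + 2 := le_antisymm hkup hklow
  have hZp : Nat.card (Subgroup.center G) = p := by
    rw [hZ]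
    refine le_antisymm (Nat.le_of_mul_le_mul_left ?_ (pow_pos hp.pos (p + 1))) hF
    calc _ ≤ _ := hMlow
      _ = p ^ (p + 1) * p := by ring
  exact ⟨rank_eq_two hπ hker hnonab htop, hM, isCyclic_of_prime_card hZp, hZp⟩

end Core

end

/-! ### Tate cohomology in degree zero -/

open CategoryTheory in
/-- An element of `Ĥ⁰` is a fixed element modulo norms, so vanishing of `Ĥ⁰` says that every fixed
element is a norm. -/
theorem exists_norm_eq_of_subsingleton_tateCohomology_zero {R Q : Type u} [CommRing R] [Group Q]
    [Fintype Q] (M : Rep R Q) (h : Subsingleton (tateCohomology M 0)) (m : M)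
    (hm : ∀ q, M.ρ q m = m) : ∃ n : M, ∑ q, M.ρ q n = m := by
  have hz : Limits.IsZero ((tateComplex M).homology 0) :=
    ModuleCat.isZero_of_subsingleton (M := tateCohomology M 0)
  have hex : (tateComplex M).ExactAt 0 :=
    (HomologicalComplex.exactAt_iff_isZero_homology _ _).2 hz
  rw [HomologicalComplex.exactAt_iff' _ (-1) 0 1 (by simp) (by simp),
    ShortComplex.moduleCat_exact_iff] at hex
  -- a fixed element is a `0`-cocycle
  have hd : ((tateComplex M).sc' (-1) 0 1).g (fun _ => m : (Fin 0 → Q) → M) = 0 := by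
    change (groupCohomology.inhomogeneousCochains M).d 0 1 (fun _ => m : (Fin 0 → Q) → M) = 0
    rw [groupCohomology.inhomogeneousCochains.d_def]
    ext x
    erw [inhomogeneousCochains.d_hom_apply]
    simp [hm]
    rfl
  obtain ⟨(c : (Fin 0 → Q) →₀ M), hc⟩ := hex _ hd
  change M.tateNorm c = _ at hc
  rw [Rep.tateNorm_eq] at hc
  have hval : ((Finsupp.lsum R fun _ ↦ LinearMap.pi fun _ ↦ M.ρ.norm) c : (Fin 0 → Q) → M) default
      = m := congrFun hc default
  refine ⟨c default, ?_⟩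
  rw [← hval]
  simp [Finsupp.sum_fintype, Representation.norm,
    Subsingleton.elim _ (default : Fin 0 → Q)]

/-! ### NS-groups -/

theorem mainTheorem2 {p : ℕ} (hp : p.Prime) (G : Type u) [Group G] [Finite G]
    (hG : IsNSGroup p G) (hcard : Nat.card G = p ^ (p + 6)) :
    Group.rank G = 2 ∧
      Nat.card (Subgroup.center (frattini G)) = p ^ (p + 2) ∧
      (IsCyclic (Subgroup.center G) ∧ Nat.card (Subgroup.center G) = p) := by
  have := Fact.mk hp
  open scoped IsMulCommutative in
    -- the Frattini quotient is abelian, so `Z(Φ(G))` is a module over a commutative group ring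
    let _ : CommGroup (G ⧸ frattini G) :=
      { (inferInstance : Group (G ⧸ frattini G)) with
        mul_comm := hG.isPGroup.quotient_frattini_mul_comm }
    let _ : Fintype (G ⧸ frattini G) := Fintype.ofFinite _
    let ρ := centerFrattiniRepresentation G
    let _ : Module (MonoidAlgebra (ULift.{u} ℤ) (G ⧸ frattini G))
        (Additive (Subgroup.center (frattini G))) :=
      Module.compHom _ (Representation.asAlgebraHom ρ).toRingHom
    have hsmul : ∀ (q : G ⧸ frattini G) (a : Additive (Subgroup.center (frattini G))),
        MonoidAlgebra.of (ULift.{u} ℤ) (G ⧸ frattini G) q • a = ρ q a := fun q a =>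
      LinearMap.congr_fun (Representation.asAlgebraHom_of ρ q) a
    refine rank_and_card_center_of_norm_eq_fixed (π := QuotientGroup.mk' (frattini G))
      (f := MonoidAlgebra.of (ULift.{u} ℤ) (G ⧸ frattini G))
      (M := Additive (Subgroup.center (frattini G)))
      (ι := fun a => ((a.toMul : frattini G) : G)) hp hG.isPGroup ?_
      (QuotientGroup.mk'_surjective _) (QuotientGroup.ker_mk' _) (fun _ _ => rfl) ?_ ?_ ?_ rfl ?_
      hG.nonabelian hcard
    · intro q
      induction q using QuotientGroup.induction_on with | _ x
      rw [← QuotientGroup.mk_pow, QuotientGroup.eq_one_iff]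
      exact hG.isPGroup.pow_mem_frattini x
    · exact fun a b h => Subtype.ext (Subtype.ext h)
    · intro x a
      rw [hsmul]
      rfl
    · intro z
      refine ⟨?_, fun ⟨hz, hc⟩ => ?_⟩
      · rintro ⟨a, rfl⟩
        exact ⟨a.toMul.1.2, fun w hw =>
          congrArg Subtype.val (Subgroup.mem_center_iff.1 a.toMul.2 ⟨w, hw⟩)⟩
      · exact ⟨Additive.ofMul ⟨⟨z, hz⟩, Subgroup.mem_center_iff.2 fun w =>
          Subtype.ext (hc w w.2)⟩, rfl⟩
    · intro m hm
      obtain ⟨n, hn⟩ := exists_norm_eq_of_subsingleton_tateCohomology_zero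
        (Rep.of (centerFrattiniRepresentation G)) hG.tate_zero m fun q => by
          rw [← hsmul q m]
          exact hm q trivial
      refine ⟨n, Eq.trans ?_ hn⟩
      let _ := Fintype.ofFinite (⊤ : Subgroup (G ⧸ frattini G))
      rw [subgroupNorm_eq_sum, Finset.sum_smul]
      exact Fintype.sum_equiv Subgroup.topEquiv.toEquiv _ _ fun q => hsmul q n
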